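/- Let $k$ be a commutative unital ring, $H$ a Hopf algebra over $k$ (comultiplication $\Delta(h)=\sum h_1\otimes h_2$, counit $\epsilon$, antipode $S$) which is finitely generated and projective as a $k$-module, with dual basis $\{(b_i,p_i)\in H\times H^*\mid 1\le i\le n\}$, i.e. $h=\sum_i p_i(h)\,b_i$ for all $h\in H$. Let $\mathcal A$ be a unital $k$-algebra with a partial Hopf action of $H$, i.e. a $k$-linear map $H\otimes\mathcal A\to\mathcal A$, $h\otimes a\mapsto h\cdot a$, such that for all $h,g\in H$ and $a,b\in\mathcal A$ $$h\cdot(ab)=\sum(h_1\cdot a)(h_2\cdot b),\qquad 1_H\cdot a=a,\qquad h\cdot(g\cdot a)=\sum(h_1\cdot 1)((h_2g)\cdot a).$$ The dual $H^*=\mathrm{Hom}_k(H,k)$ is a Hopf algebra with product $(f*g)(h)=\sum f(h_1)g(h_2)$, unit $\epsilon$, coproduct determined by $f(xy)=\sum f_1(x)f_2(y)$, counit $f\mapsto f(1)$ and antipode $S(f)=f\circ S$. Write $f\rightharpoonup h=\sum h_1f(h_2)$, $h\leftharpoonup f=\sum h_2f(h_1)$, and $$\lambda(h\# f)(x)=h(f\rightharpoonup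 x),\qquad \rho(f\# h)(x)=(x\leftharpoonup f)h\qquad(x\in H),$$ which are elements of $\mathrm{End}(H)=\mathrm{End}_k(H)$. Let $\mathcal A\otimes H\# H^*$ be the (associative, in general non-unital) algebra $\mathcal A\otimes H\otimes H^*$ with product $$(a\otimes h\# f)(b\otimes g\# l)=\sum a(h_1\cdot b)\otimes h_2(f_1\rightharpoonup g)\# f_2*l .$$ Let $\underline{\mathcal A\# H}\subseteq\mathcal A\otimes H$ be the partial smash product, i.e. the $k$-span of the elements $\sum a(h_1\cdot 1_{\mathcal A})\otimes h_2$, and $\underline{\mathcal A\# H}\# H^*\subseteq\mathcal A\otimes H\# H^*$ the span of all $x\# f$ with $x\in\underline{\mathcal A\# H}$, $f\in H^*$. Theorem. The antipode of $H^*$ is bijective. With $$\phi(a)=\sum_{i=1}^n(b_i\cdot a)\otimes\rho(S^{-1}(p_i)\#1),\qquad \psi(h\# f)=1\otimes\lambda(h\# f),$$ $S^{-1}$ being the inverse of the antipode of $H^*$, the map $$\Phi:\mathcal A\otimes H\# H^*\to\mathcal A\otimes\mathrm{End}(H),\qquad a\otimes h\# f\mapsto\phi(a)\psi(h\# f),$$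 is a well-defined homomorphism of (not necessarily unital) $k$-algebras. The element $$\mathbf e=\sum_{i=1}^n(b_i\cdot 1)\otimes\rho(S^{-1}(p_i)\#1)$$ is idempotent, and $\Phi$ maps $\underline{\mathcal A\# H}\# H^*$ into $\mathbf e\,(\mathcal A\otimes\mathrm{End}(H))\,\mathbf e$. -/

import Mathlib

open scoped TensorProduct
open WithConv

noncomputable section

namespace HopfDuality

/-! ### Finite dual bases -/

section DualBasis

variable (k : Type*) [CommRing k] (M : Type*) [AddCommGroup M] [Module k M]

theorem exists_dualBasis [Module.Finite k M] [Module.Projective k M] :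
    ∃ (n : ℕ) (b : Fin n → M) (p : Fin n → (M →ₗ[k] k)), ∀ x, ∑ i, p i x • b i = x := by
  obtain ⟨n, f, g, -, -, h⟩ := Module.Finite.exists_comp_eq_id_of_projective k M
  refine ⟨n, fun i => f (Pi.single i 1), fun i => LinearMap.proj i ∘ₗ g, fun x => ?_⟩
  have hx : f (g x) = x := LinearMap.congr_fun h x
  conv_rhs => rw [← hx, pi_eq_sum_univ' (g x), map_sum]
  simp only [map_smul, LinearMap.comp_apply, LinearMap.proj_apply]

end DualBasis

/-! ### The dual Hopf algebra -/

/-- The linear dual `H^* = Hom_k(H, k)`; the wrapper `WithConv` gives it the convolution product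
`(f * g)(h) = ∑ f(h₁) g(h₂)` and the unit `ε`. -/
abbrev HDual (k H : Type*) [CommRing k] [Ring H] [HopfAlgebra k H] : Type _ :=
  WithConv (H →ₗ[k] k)

section Dual

variable {k H : Type*} [CommRing k] [Ring H] [HopfAlgebra k H]

/-- The linear form `y ↦ f (x * y)`. -/
def HDual.mulShift (f : HDual k H) (x : H) : HDual k H :=
  toConv (f.ofConv ∘ₗ LinearMap.mulLeft k x)

@[simp] theorem HDual.mulShift_apply (f : HDual k H) (x y : H) :
    (f.mulShift x).ofConv y = f.ofConv (x * y) := rfl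

/-- Partial evaluation `f ⊗ m ↦ f(x) m`. -/
def evalLeft (M : Type*) [AddCommMonoid M] [Module k M] (x : H) : HDual k H ⊗[k] M →ₗ[k] M :=
  TensorProduct.lift
    (LinearMap.mk₂ k (fun (f : HDual k H) (m : M) => f.ofConv x • m)
      (fun f g m => by simp [add_smul]) (fun c f m => by simp [mul_smul])
      (fun f m m' => by simp) (fun c f m => by simp [smul_comm c]))

@[simp] theorem evalLeft_tmul (M : Type*) [AddCommMonoid M] [Module k M] (x : H)
    (f : HDual k H) (m : M) : evalLeft M x (f ⊗ₜ[k] m) = f.ofConv x • m := by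
  simp [evalLeft]

variable [Module.Finite k H] [Module.Projective k H]

theorem evalLeft_ext {M : Type*} [AddCommMonoid M] [Module k M] {s t : HDual k H ⊗[k] M}
    (h : ∀ x, evalLeft M x s = evalLeft M x t) : s = t := by
  obtain ⟨n, b, p, hbp⟩ := exists_dualBasis k H
  have key : ∀ u : HDual k H ⊗[k] M, u = ∑ i, toConv (p i) ⊗ₜ[k] evalLeft M (b i) u := by
    intro u
    induction u with
    | zero => simp
    | add u v hu hv =>
      conv_lhs => rw [hu, hv]
      simp [TensorProduct.tmul_add, Finset.sum_add_distrib]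
    | tmul f m =>
      simp only [evalLeft_tmul, ← TensorProduct.smul_tmul, ← TensorProduct.sum_tmul]
      congr 1
      ext x
      conv_lhs => rw [← hbp x]
      simp [mul_comm]
  rw [key s, key t]
  simp [h]

/-- The comultiplication of `H^*`: `Δ(f) = ∑ f₁ ⊗ f₂` with `f(xy) = ∑ f₁(x) f₂(y)`. It is written
as `Δ(f) = ∑ f(bᵢ bⱼ) pᵢ ⊗ pⱼ` for a chosen dual basis of `H`; see `HDual.comul_eq_sum` for
independence of this choice. -/
def HDual.comulMap : HDual k H →ₗ[k] HDual k H ⊗[k] HDual k H :=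
  let b := (exists_dualBasis k H).choose_spec.choose
  let p := (exists_dualBasis k H).choose_spec.choose_spec.choose
  ∑ i, ∑ j, ((LinearMap.applyₗ (b i * b j)) ∘ₗ
    (WithConv.linearEquiv k (H →ₗ[k] k)).toLinearMap).smulRight (toConv (p i) ⊗ₜ[k] toConv (p j))

theorem HDual.evalLeft_comulMap (f : HDual k H) (x : H) :
    evalLeft _ x (HDual.comulMap f) = f.mulShift x := by
  have hbp := (exists_dualBasis k H).choose_spec.choose_spec.choose_spec
  ext y
  conv_rhs => rw [HDual.mulShift_apply, ← hbp x, ← hbp y]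
  simp only [HDual.comulMap, LinearMap.sum_apply, map_sum, LinearMap.smulRight_apply, map_smul,
    evalLeft_tmul, ofConv_sum, ofConv_smul, LinearMap.smul_apply, Finset.sum_mul_sum,
    smul_mul_smul_comm, LinearMap.comp_apply, LinearMap.applyₗ_apply_apply, smul_eq_mul,
    LinearEquiv.coe_coe, WithConv.linearEquiv_apply]
  exact Finset.sum_congr rfl fun i _ => Finset.sum_congr rfl fun j _ => by ring

instance HDual.instCoalgebra : Coalgebra k (HDual k H) where
  comul := HDual.comulMap
  counit := (LinearMap.applyₗ (1 : H)) ∘ₗ (WithConv.linearEquiv k (H →ₗ[k] k)).toLinearMap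
  coassoc := by
    ext f : 1
    refine evalLeft_ext (M := HDual k H ⊗[k] HDual k H) fun x => ?_
    refine evalLeft_ext fun y => ?_
    have h1 : ∀ t : HDual k H ⊗[k] HDual k H, evalLeft _ y (evalLeft _ x
        (TensorProduct.assoc k _ _ _ (HDual.comulMap.rTensor (HDual k H) t))) =
          evalLeft _ (x * y) t := by
      intro t
      induction t with
      | zero => simp
      | add u v hu hv => simp only [map_add, hu, hv]
      | tmul g m =>
        have h2 : ∀ s : HDual k H ⊗[k] HDual k H, evalLeft _ y (evalLeft _ x
            (TensorProduct.assoc k _ _ _ (s ⊗ₜ[k] m))) = (evalLeft _ x s).ofConv y • m := by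
          intro s
          induction s with
          | zero => simp
          | add u v hu hv => simp only [TensorProduct.add_tmul, map_add, hu, hv, ofConv_add,
              LinearMap.add_apply, add_smul]
          | tmul g h => simp [mul_smul]
        simp [h2, HDual.evalLeft_comulMap]
    have h3 : ∀ t : HDual k H ⊗[k] HDual k H, evalLeft _ x (HDual.comulMap.lTensor (HDual k H) t) =
        HDual.comulMap (evalLeft _ x t) := by
      intro t
      induction t with
      | zero => simp
      | add u v hu hv => simp only [map_add, hu, hv]
      | tmul g m => simp
    simp only [LinearMap.comp_apply, LinearEquiv.coe_coe, h1, h3, HDual.evalLeft_comulMap]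
    ext z
    simp [mul_assoc]
  rTensor_counit_comp_comul := by
    ext f : 1
    apply (TensorProduct.lid k (HDual k H)).injective
    have h : ∀ t : HDual k H ⊗[k] HDual k H, TensorProduct.lid k _ (LinearMap.rTensor (HDual k H)
        ((LinearMap.applyₗ (1 : H)) ∘ₗ (WithConv.linearEquiv k (H →ₗ[k] k)).toLinearMap) t) =
          evalLeft _ 1 t := by
      intro t
      induction t with
      | zero => simp
      | add u v hu hv => simp only [map_add, hu, hv]
      | tmul g m => simp
    rw [LinearMap.comp_apply, h, HDual.evalLeft_comulMap]
    ext y; simp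
  lTensor_counit_comp_comul := by
    ext f : 1
    apply evalLeft_ext; intro x
    have h : ∀ t : HDual k H ⊗[k] HDual k H, evalLeft _ x (LinearMap.lTensor (HDual k H)
        ((LinearMap.applyₗ (1 : H)) ∘ₗ (WithConv.linearEquiv k (H →ₗ[k] k)).toLinearMap) t) =
          (evalLeft _ x t).ofConv 1 := by
      intro t
      induction t with
      | zero => simp
      | add u v hu hv => simp only [map_add, hu, hv, ofConv_add, LinearMap.add_apply]
      | tmul g m => simp
    rw [LinearMap.comp_apply, h, HDual.evalLeft_comulMap]
    simp

@[simp] theorem HDual.counit_apply (f : HDual k H) :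
    Coalgebra.counit (R := k) f = f.ofConv 1 := rfl

@[simp] theorem HDual.evalLeft_comul (f : HDual k H) (x : H) :
    evalLeft _ x (Coalgebra.comul (R := k) f) = f.mulShift x :=
  HDual.evalLeft_comulMap f x

theorem HDual.comul_eq_sum {n : ℕ} (b : Fin n → H) (p : Fin n → HDual k H)
    (hbp : ∀ h, ∑ i, (p i).ofConv h • b i = h) (f : HDual k H) :
    Coalgebra.comul (R := k) f = ∑ i, ∑ j, f.ofConv (b i * b j) • (p i ⊗ₜ[k] p j) := by
  apply evalLeft_ext; intro x
  ext y
  conv_lhs => rw [HDual.evalLeft_comul, HDual.mulShift_apply, ← hbp x, ← hbp y]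
  simp only [map_sum, map_smul, evalLeft_tmul, ofConv_sum, ofConv_smul, LinearMap.smul_apply,
    LinearMap.sum_apply, Finset.sum_mul_sum, smul_mul_smul_comm, smul_eq_mul]
  exact Finset.sum_congr rfl fun i _ => Finset.sum_congr rfl fun j _ => by ring

open Coalgebra in
instance HDual.instBialgebra : Bialgebra k (HDual k H) :=
  Bialgebra.mk' k (HDual k H)
    (by simp)
    (by intro f g; simp [Algebra.TensorProduct.one_def])
    (by
      apply evalLeft_ext; intro x
      rw [HDual.evalLeft_comul, Algebra.TensorProduct.one_def]
      ext y; simp)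
    (by
      intro f g
      apply evalLeft_ext; intro x
      have h : ∀ s t : HDual k H ⊗[k] HDual k H, evalLeft _ x (s * t) =
          ∑ i ∈ (ℛ k x).index, evalLeft _ ((ℛ k x).left i) s * evalLeft _ ((ℛ k x).right i) t := by
        intro s t
        induction s with
        | zero => rw [show (0 : HDual k H ⊗[k] HDual k H) * t = 0 from zero_mul t]; simp
        | add u v hu hv =>
          rw [show (u + v) * t = u * t + v * t from
            Distrib.right_distrib (R := HDual k H ⊗[k] HDual k H) u v t]
          simp only [map_add, add_mul, hu, hv, Finset.sum_add_distrib]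
        | tmul a a' =>
          induction t with
          | zero =>
            rw [show (a ⊗ₜ[k] a') * (0 : HDual k H ⊗[k] HDual k H) = 0 from
              MulZeroClass.mul_zero (M₀ := HDual k H ⊗[k] HDual k H) _]; simp
          | add u v hu hv =>
            rw [show (a ⊗ₜ[k] a') * (u + v) = (a ⊗ₜ[k] a') * u + (a ⊗ₜ[k] a') * v from
              Distrib.left_distrib (R := HDual k H ⊗[k] HDual k H) _ u v]
            simp only [map_add, mul_add, hu, hv, Finset.sum_add_distrib]
          | tmul c c' =>
            simp only [Algebra.TensorProduct.tmul_mul_tmul, evalLeft_tmul,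
              (ℛ k x).convMul_apply, Finset.sum_smul, smul_mul_smul_comm]
      rw [h]
      simp only [HDual.evalLeft_comul]
      ext y
      rw [HDual.mulShift_apply, Coalgebra.Repr.convMul_apply ((ℛ k x).mul (ℛ k y))]
      simp only [ofConv_sum, LinearMap.sum_apply, (ℛ k y).convMul_apply]
      simp [Coalgebra.Repr.mul, Coalgebra.Repr.induced, Coalgebra.Repr.tmul,
        Finset.sum_product])

open Coalgebra in
/-- `H^*` is a Hopf algebra with antipode `S(f) = f ∘ S`. -/
instance HDual.instHopfAlgebra : HopfAlgebra k (HDual k H) where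
  antipode := (WithConv.linearEquiv k (H →ₗ[k] k)).symm.toLinearMap ∘ₗ
    (LinearMap.lcomp k k (HopfAlgebra.antipode k (A := H))) ∘ₗ
    (WithConv.linearEquiv k (H →ₗ[k] k)).toLinearMap
  mul_antipode_rTensor_comul := by
    ext f : 1
    ext x
    have h : ∀ t : HDual k H ⊗[k] HDual k H, (LinearMap.mul' k (HDual k H)
        (LinearMap.rTensor (HDual k H) ((WithConv.linearEquiv k (H →ₗ[k] k)).symm.toLinearMap ∘ₗ
          (LinearMap.lcomp k k (HopfAlgebra.antipode k (A := H))) ∘ₗ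
          (WithConv.linearEquiv k (H →ₗ[k] k)).toLinearMap) t)).ofConv x =
        ∑ i ∈ (ℛ k x).index, (evalLeft _ (HopfAlgebra.antipode k ((ℛ k x).left i)) t).ofConv
          ((ℛ k x).right i) := by
      intro t
      induction t with
      | zero => simp
      | add u v hu hv => simp only [map_add, hu, hv, Finset.sum_add_distrib, ofConv_add,
          LinearMap.add_apply]
      | tmul a a' =>
        rw [LinearMap.rTensor_tmul, LinearMap.mul'_apply, (ℛ k x).convMul_apply]
        simp
    rw [LinearMap.comp_apply, LinearMap.comp_apply, h]
    simp only [HDual.evalLeft_comul, HDual.mulShift_apply, ← map_sum,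
      HopfAlgebra.sum_antipode_mul_eq_smul (ℛ k x)]
    simp [Algebra.algebraMap_eq_smul_one, mul_comm]
  mul_antipode_lTensor_comul := by
    ext f : 1
    ext x
    have h : ∀ t : HDual k H ⊗[k] HDual k H, (LinearMap.mul' k (HDual k H)
        (LinearMap.lTensor (HDual k H) ((WithConv.linearEquiv k (H →ₗ[k] k)).symm.toLinearMap ∘ₗ
          (LinearMap.lcomp k k (HopfAlgebra.antipode k (A := H))) ∘ₗ
          (WithConv.linearEquiv k (H →ₗ[k] k)).toLinearMap) t)).ofConv x =
        ∑ i ∈ (ℛ k x).index, (evalLeft _ ((ℛ k x).left i) t).ofConv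
          (HopfAlgebra.antipode k ((ℛ k x).right i)) := by
      intro t
      induction t with
      | zero => simp
      | add u v hu hv => simp only [map_add, hu, hv, Finset.sum_add_distrib, ofConv_add,
          LinearMap.add_apply]
      | tmul a a' =>
        rw [LinearMap.lTensor_tmul, LinearMap.mul'_apply, (ℛ k x).convMul_apply]
        simp
    rw [LinearMap.comp_apply, LinearMap.comp_apply, h]
    simp only [HDual.evalLeft_comul, HDual.mulShift_apply, ← map_sum,
      HopfAlgebra.sum_mul_antipode_eq_smul (ℛ k x)]
    simp [Algebra.algebraMap_eq_smul_one, mul_comm]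

@[simp] theorem HDual.antipode_apply (f : HDual k H) (x : H) :
    (HopfAlgebra.antipode k f).ofConv x = f.ofConv (HopfAlgebra.antipode k x) := rfl

end Dual

/-! ### Smash products -/

section Smash

variable {k B R : Type*} [CommRing k] [Ring B] [Bialgebra k B]
  [NonUnitalRing R] [Module k R] [IsScalarTower k R R] [SMulCommClass k R R]

/-- The map `s ⊗ c ↦ ∑ (b₁ · s) ⊗ b₂ c` for a bilinear map `act : (b, s) ↦ b · s`. -/
def diagAct (act : B →ₗ[k] R →ₗ[k] R) : B →ₗ[k] R ⊗[k] B →ₗ[k] R ⊗[k] B :=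
  TensorProduct.homTensorHomMap (RingHom.id k) R B R B ∘ₗ
    TensorProduct.map act (LinearMap.mul k B) ∘ₗ Coalgebra.comul

/-- The smash product multiplication `(r ⊗ b)(s ⊗ c) = ∑ r (b₁ · s) ⊗ b₂ c`. -/
def smashMul (act : B →ₗ[k] R →ₗ[k] R) : R ⊗[k] B →ₗ[k] R ⊗[k] B →ₗ[k] R ⊗[k] B :=
  TensorProduct.lift (LinearMap.mk₂ k
    (fun r b => (LinearMap.mulLeft k r).rTensor B ∘ₗ diagAct act b)
    (fun r r' b => by
      rw [← LinearMap.add_comp, ← LinearMap.rTensor_add]; congr; ext; simp [add_mul])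
    (fun c r b => by
      rw [← LinearMap.smul_comp, ← LinearMap.rTensor_smul]; congr; ext; simp [smul_mul_assoc])
    (fun r b b' => by rw [map_add, LinearMap.comp_add])
    (fun c r b => by rw [map_smul, LinearMap.comp_smul]))

theorem smashMul_tmul (act : B →ₗ[k] R →ₗ[k] R) {ι : Type*} (r s : R) (b c : B)
    (rb : Coalgebra.Repr k b ι) :
    smashMul act (r ⊗ₜ b) (s ⊗ₜ c) =
      ∑ i ∈ rb.index, (r * act (rb.left i) s) ⊗ₜ[k] (rb.right i * c) := by
  simp [smashMul, diagAct, ← rb.eq, map_sum]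

open Coalgebra in
theorem smashMul_assoc (act : B →ₗ[k] R →ₗ[k] R)
    (h1 : ∀ b r s, act b (r * s) =
      ∑ i ∈ (ℛ k b).index, act ((ℛ k b).left i) r * act ((ℛ k b).right i) s)
    (h2 : ∀ b c r s,
      ∑ i ∈ (ℛ k b).index, act ((ℛ k b).left i) r * act ((ℛ k b).right i) (act c s) =
        ∑ i ∈ (ℛ k b).index, act ((ℛ k b).left i) r * act ((ℛ k b).right i * c) s)
    (x y z : R ⊗[k] B) :
    smashMul act (smashMul act x y) z = smashMul act x (smashMul act y z) := by
  induction x with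
  | zero => simp
  | add u v hu hv => simp only [map_add, LinearMap.add_apply, hu, hv]
  | tmul r b =>
  induction y with
  | zero => simp
  | add u v hu hv => simp only [map_add, LinearMap.add_apply, hu, hv]
  | tmul s c =>
  induction z with
  | zero => simp
  | add u v hu hv => simp only [map_add, hu, hv]
  | tmul t d =>
    rw [smashMul_tmul act r s b c (ℛ k b), smashMul_tmul act s t c d (ℛ k c)]
    simp only [map_sum, LinearMap.sum_apply]
    have e1 : ∀ i, smashMul act ((r * act ((ℛ k b).left i) s) ⊗ₜ[k] ((ℛ k b).right i * c))
        (t ⊗ₜ d) = ∑ j ∈ (ℛ k ((ℛ k b).right i)).index, ∑ l ∈ (ℛ k c).index,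
          (r * act ((ℛ k b).left i) s *
            act ((ℛ k ((ℛ k b).right i)).left j * (ℛ k c).left l) t) ⊗ₜ[k]
            ((ℛ k ((ℛ k b).right i)).right j * (ℛ k c).right l * d) := by
      intro i
      rw [smashMul_tmul act _ _ _ _ ((ℛ k ((ℛ k b).right i)).mul (ℛ k c))]
      simp [Coalgebra.Repr.mul, Coalgebra.Repr.induced, Coalgebra.Repr.tmul, Finset.sum_product]
    have e2 : ∀ l, smashMul act (r ⊗ₜ b)
        ((s * act ((ℛ k c).left l) t) ⊗ₜ[k] ((ℛ k c).right l * d)) =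
        ∑ i ∈ (ℛ k b).index, ∑ j ∈ (ℛ k ((ℛ k b).left i)).index,
          (r * act ((ℛ k ((ℛ k b).left i)).left j) s *
            act ((ℛ k ((ℛ k b).left i)).right j * (ℛ k c).left l) t) ⊗ₜ[k]
            ((ℛ k b).right i * (ℛ k c).right l * d) := by
      intro l
      rw [smashMul_tmul act _ _ _ _ (ℛ k b)]
      refine Finset.sum_congr rfl fun i _ => ?_
      rw [h1, h2, Finset.mul_sum, TensorProduct.sum_tmul]
      simp only [mul_assoc]
    simp only [e1, e2]
    rw [Finset.sum_congr rfl fun i _ => Finset.sum_comm, Finset.sum_comm]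
    refine Finset.sum_congr rfl fun l _ => ?_
    have := congrArg ((LinearMap.mulLeft k r ∘ₗ LinearMap.mul' k R).rTensor B ∘ₗ
      (TensorProduct.assoc k R R B).symm.toLinearMap ∘ₗ
      TensorProduct.map (act.flip s) (TensorProduct.map
        (act.flip t ∘ₗ LinearMap.mulRight k ((ℛ k c).left l))
        (LinearMap.mulRight k ((ℛ k c).right l * d))))
      (Coalgebra.sum_tmul_tmul_eq (ℛ k b) (fun i => ℛ k _) (fun i => ℛ k _))
    simp only [map_sum, TensorProduct.map_tmul, LinearMap.comp_apply, LinearMap.mulLeft_apply,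
      LinearMap.mulRight_apply, LinearMap.flip_apply, LinearEquiv.coe_coe,
      TensorProduct.assoc_symm_tmul, LinearMap.rTensor_tmul, LinearMap.mul'_apply,
      ← mul_assoc] at this
    exact this.symm

end Smash

/-! ### Partial Hopf actions -/

/-- A partial action of the Hopf algebra `H` on the unital `k`-algebra `A`. -/
structure PartialHopfAction (k H A : Type*) [CommRing k] [Ring H] [HopfAlgebra k H]
    [Ring A] [Algebra k A] where
  /-- the bilinear map `(h, a) ↦ h · a` -/
  act : H →ₗ[k] A →ₗ[k] A
  /-- `h · (ab) = ∑ (h₁ · a)(h₂ · b)` -/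
  act_mul : ∀ (h : H) (a b : A), act h (a * b) =
    LinearMap.mul' k A (TensorProduct.map (act.flip a) (act.flip b) (Coalgebra.comul h))
  /-- `1 · a = a` -/
  one_act : ∀ a : A, act 1 a = a
  /-- `h · (g · a) = ∑ (h₁ · 1)((h₂ g) · a)` -/
  act_act : ∀ (h g : H) (a : A), act h (act g a) =
    LinearMap.mul' k A (TensorProduct.map (act.flip 1) (act.flip a ∘ₗ LinearMap.mulRight k g)
      (Coalgebra.comul h))

namespace PartialHopfAction

variable {k H A : Type*} [CommRing k] [Ring H] [HopfAlgebra k H] [Ring A] [Algebra k A]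

open Coalgebra in
theorem act_mul_repr (α : PartialHopfAction k H A) (h : H) (a b : A) {ι : Type*}
    (r : Coalgebra.Repr k h ι) :
    α.act h (a * b) = ∑ i ∈ r.index, α.act (r.left i) a * α.act (r.right i) b := by
  rw [α.act_mul, ← r.eq]; simp

open Coalgebra in
theorem act_act_repr (α : PartialHopfAction k H A) (h g : H) (a : A) {ι : Type*}
    (r : Coalgebra.Repr k h ι) :
    α.act h (α.act g a) = ∑ i ∈ r.index, α.act (r.left i) 1 * α.act (r.right i * g) a := by
  rw [α.act_act, ← r.eq]; simp

open Coalgebra in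
theorem sum_act_mul_act_act (α : PartialHopfAction k H A) (h g : H) (a b : A) :
    ∑ i ∈ (ℛ k h).index, α.act ((ℛ k h).left i) a * α.act ((ℛ k h).right i) (α.act g b) =
      ∑ i ∈ (ℛ k h).index, α.act ((ℛ k h).left i) a * α.act ((ℛ k h).right i * g) b := by
  have := congrArg (LinearMap.mul' k A ∘ₗ
    TensorProduct.map (α.act.flip a) (LinearMap.mul' k A ∘ₗ
      TensorProduct.map (α.act.flip 1) (α.act.flip b ∘ₗ LinearMap.mulRight k g)))
    (Coalgebra.sum_tmul_tmul_eq (ℛ k h) (fun i => ℛ k _) (fun i => ℛ k _))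
  simp only [map_sum, LinearMap.comp_apply, TensorProduct.map_tmul, LinearMap.flip_apply,
    LinearMap.mul'_apply, LinearMap.mulRight_apply] at this
  simp only [α.act_act_repr _ g b (ℛ k _), Finset.mul_sum]
  rw [← this]
  refine Finset.sum_congr rfl fun i _ => ?_
  simp only [← mul_assoc, ← Finset.sum_mul]
  rw [← α.act_mul_repr, mul_one]

/-- The associative, in general non-unital, algebra `A ⊗ H` with product
`(a ⊗ h)(b ⊗ g) = ∑ a (h₁ · b) ⊗ h₂ g`. -/
def Ambient (_α : PartialHopfAction k H A) : Type _ := A ⊗[k] H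

variable (α : PartialHopfAction k H A)

instance : AddCommGroup α.Ambient := inferInstanceAs (AddCommGroup (A ⊗[k] H))
instance : Module k α.Ambient := inferInstanceAs (Module k (A ⊗[k] H))

/-- The pure tensor `a ⊗ h`, as an element of `A ⊗ H`. -/
def Ambient.mk (a : A) (h : H) : α.Ambient := (a ⊗ₜ[k] h : A ⊗[k] H)

instance : NonUnitalRing α.Ambient where
  __ := (inferInstance : AddCommGroup α.Ambient)
  mul x y := smashMul α.act x y
  left_distrib x y z := map_add (smashMul α.act x) y z
  right_distrib x y z := LinearMap.map_add₂ (smashMul α.act) x y z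
  zero_mul x := LinearMap.map_zero₂ (smashMul α.act) x
  mul_zero x := map_zero (smashMul α.act x)
  mul_assoc := smashMul_assoc α.act (fun h a b => α.act_mul_repr h a b _)
    (fun h g a b => α.sum_act_mul_act_act h g a b)

instance : IsScalarTower k α.Ambient α.Ambient :=
  ⟨fun c x y => LinearMap.map_smul₂ (smashMul α.act) c x y⟩

instance : SMulCommClass k α.Ambient α.Ambient :=
  ⟨fun c x y => (map_smul (smashMul α.act x) c y).symm⟩

theorem Ambient.mk_mul_mk (a b : A) (h g : H) {ι : Type*} (r : Coalgebra.Repr k h ι) :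
    Ambient.mk α a h * Ambient.mk α b g =
      ∑ i ∈ r.index, Ambient.mk α (a * α.act (r.left i) b) (r.right i * g) :=
  smashMul_tmul α.act a b h g r

/-- The partial smash product `(A ⊗ H) 1_A`, i.e. the set of all `x (1 ⊗ 1)`, `x ∈ A ⊗ H`. -/
def partialSmash : Submodule k α.Ambient :=
  LinearMap.range (LinearMap.mulRight k (Ambient.mk α 1 1))

end PartialHopfAction

/-! ### The actions of `H^*` on `H` and the Heisenberg double -/

section Heisenberg

variable (k H : Type*) [CommRing k] [Ring H] [HopfAlgebra k H]

/-- `f ⇀ h = ∑ h₁ f(h₂)`. -/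
def hitLeft : HDual k H →ₗ[k] H →ₗ[k] H :=
  LinearMap.mk₂ k (fun f h => TensorProduct.rid k H (f.ofConv.lTensor H (Coalgebra.comul h)))
    (fun f g h => by simp [LinearMap.lTensor_add]) (fun c f h => by simp [LinearMap.lTensor_smul])
    (fun f h h' => by simp) (fun c f h => by simp)

/-- `h ↼ f = ∑ h₂ f(h₁)`. -/
def hitRight : H →ₗ[k] HDual k H →ₗ[k] H :=
  LinearMap.mk₂ k (fun h f => TensorProduct.lid k H (f.ofConv.rTensor H (Coalgebra.comul h)))
    (fun h h' f => by simp) (fun c h f => by simp)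
    (fun h f g => by simp [LinearMap.rTensor_add]) (fun c h f => by simp [LinearMap.rTensor_smul])

/-- `λ(h # f)(x) = h (f ⇀ x)`. -/
def lam : H ⊗[k] HDual k H →ₗ[k] Module.End k H :=
  TensorProduct.lift (LinearMap.mk₂ k
    (fun h f => LinearMap.mulLeft k h ∘ₗ hitLeft k H f)
    (fun h h' f => by ext; simp [add_mul]) (fun c h f => by ext; simp)
    (fun h f f' => by ext; simp [mul_add]) (fun c h f => by ext; simp))

/-- `ρ(f # h)(x) = (x ↼ f) h`. -/
def rho : HDual k H ⊗[k] H →ₗ[k] Module.End k H :=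
  TensorProduct.lift (LinearMap.mk₂ k
    (fun f h => LinearMap.mulRight k h ∘ₗ (hitRight k H).flip f)
    (fun f f' h => by ext; simp [add_mul]) (fun c f h => by ext; simp)
    (fun f h h' => by ext; simp [mul_add]) (fun c f h => by ext; simp))

@[simp] theorem lam_tmul_apply (h x : H) (f : HDual k H) :
    lam k H (h ⊗ₜ f) x = h * hitLeft k H f x := by simp [lam]

@[simp] theorem rho_tmul_apply (h x : H) (f : HDual k H) :
    rho k H (f ⊗ₜ h) x = hitRight k H x f * h := by simp [rho]

variable {k H}

open Coalgebra in
theorem hitLeft_apply (f : HDual k H) (h : H) {ι : Type*} (r : Coalgebra.Repr k h ι) :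
    hitLeft k H f h = ∑ i ∈ r.index, f.ofConv (r.right i) • r.left i := by
  simp [hitLeft, ← r.eq, map_sum]

open Coalgebra in
theorem hitRight_apply (f : HDual k H) (h : H) {ι : Type*} (r : Coalgebra.Repr k h ι) :
    hitRight k H h f = ∑ i ∈ r.index, f.ofConv (r.left i) • r.right i := by
  simp [hitRight, ← r.eq, map_sum]

open Coalgebra in
theorem hitLeft_hitLeft (f g : HDual k H) (h : H) :
    hitLeft k H f (hitLeft k H g h) = hitLeft k H (f * g) h := by
  have := congrArg (TensorProduct.lift (LinearMap.lsmul k H).flip ∘ₗ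
      TensorProduct.map LinearMap.id (LinearMap.mul' k k ∘ₗ TensorProduct.map f.ofConv g.ofConv))
      (Coalgebra.sum_tmul_tmul_eq (ℛ k h) (fun i => ℛ k _) (fun i => ℛ k _))
  simp only [map_sum, TensorProduct.map_tmul, LinearMap.comp_apply, LinearMap.mul'_apply,
    TensorProduct.lift.tmul, LinearMap.flip_apply, LinearMap.lsmul_apply, LinearMap.id_apply] at this
  rw [hitLeft_apply g h (ℛ k h), hitLeft_apply (f * g) h (ℛ k h)]
  simp only [map_sum, map_smul]
  simp only [hitLeft_apply f _ (ℛ k _), (ℛ k _).convMul_apply,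
    Finset.smul_sum, Finset.sum_smul, ← this, smul_smul, mul_comm]

open Coalgebra in
theorem comul_hitLeft (f : HDual k H) (h : H) :
    comul (R := k) (hitLeft k H f h) = (hitLeft k H f).lTensor H (comul h) := by
  have := congrArg (((TensorProduct.rid k H).toLinearMap ∘ₗ f.ofConv.lTensor H).lTensor H)
      (Coalgebra.sum_tmul_tmul_eq (ℛ k h) (fun i => ℛ k _) (fun i => ℛ k _))
  simp only [map_sum, LinearMap.lTensor_tmul, LinearMap.comp_apply, LinearEquiv.coe_coe,
    TensorProduct.rid_tmul] at this
  rw [hitLeft_apply f h (ℛ k h), ← (ℛ k h).eq]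
  simp only [map_sum, map_smul, LinearMap.lTensor_tmul, hitLeft_apply f _ (ℛ k _),
    TensorProduct.tmul_sum, ← this]
  refine Finset.sum_congr rfl fun i _ => ?_
  rw [← (ℛ k ((ℛ k h).left i)).eq, Finset.smul_sum]
  simp

open Coalgebra in
theorem hitLeft_mul [Module.Finite k H] [Module.Projective k H] (f : HDual k H) (h g : H) :
    hitLeft k H f (h * g) = ∑ i ∈ (ℛ k f).index,
      hitLeft k H ((ℛ k f).left i) h * hitLeft k H ((ℛ k f).right i) g := by
  have hf : ∀ x y, f.ofConv (x * y) = ∑ i ∈ (ℛ k f).index,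
      ((ℛ k f).left i).ofConv x * ((ℛ k f).right i).ofConv y := by
    intro x y
    rw [← HDual.mulShift_apply, ← HDual.evalLeft_comul, ← (ℛ k f).eq]
    simp
  rw [hitLeft_apply f _ ((ℛ k h).mul (ℛ k g))]
  simp only [hitLeft_apply _ h (ℛ k h), hitLeft_apply _ g (ℛ k g), Finset.sum_mul_sum,
    smul_mul_smul_comm]
  simp only [Coalgebra.Repr.mul, Coalgebra.Repr.induced, Coalgebra.Repr.tmul,
    Finset.sum_product, Function.comp_apply]
  have hm : ∀ x y : H, Bialgebra.mulCoalgHom k H (x ⊗ₜ y) = x * y := fun _ _ => by simp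
  simp only [hm, hf, Finset.sum_smul]
  rw [Finset.sum_congr rfl fun i _ => Finset.sum_comm, Finset.sum_comm]

end Heisenberg

/-! ### The double smash product and the duality map -/

namespace PartialHopfAction

variable {k H A : Type*} [CommRing k] [Ring H] [HopfAlgebra k H] [Ring A] [Algebra k A]
  (α : PartialHopfAction k H A)

/-- The action `f ▷ (a ⊗ h) = a ⊗ (f ⇀ h)` of `H^*` on `A ⊗ H`. -/
def dualAct : HDual k H →ₗ[k] α.Ambient →ₗ[k] α.Ambient :=
  (LinearMap.lTensorHom A ∘ₗ hitLeft k H : HDual k H →ₗ[k] A ⊗[k] H →ₗ[k] A ⊗[k] H)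

@[simp] theorem dualAct_mk (f : HDual k H) (a : A) (h : H) :
    α.dualAct f (Ambient.mk α a h) = Ambient.mk α a (hitLeft k H f h) := by
  simp only [dualAct, Ambient.mk]
  exact LinearMap.lTensor_tmul _ _ _ _

theorem Ambient.induction {P : α.Ambient → Prop} (x : α.Ambient) (h0 : P 0)
    (hmk : ∀ a h, P (Ambient.mk α a h)) (hadd : ∀ x y, P x → P y → P (x + y)) : P x :=
  TensorProduct.induction_on (motive := P) x h0 hmk hadd

theorem dualAct_dualAct (f g : HDual k H) (x : α.Ambient) :
    α.dualAct f (α.dualAct g x) = α.dualAct (f * g) x := by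
  induction x using Ambient.induction with
  | h0 => simp
  | hmk a h => simp [hitLeft_hitLeft]
  | hadd x y hx hy => simp only [map_add, hx, hy]

open Coalgebra in
theorem dualAct_mul [Module.Finite k H] [Module.Projective k H] (f : HDual k H)
    (x y : α.Ambient) : α.dualAct f (x * y) = ∑ i ∈ (ℛ k f).index,
      α.dualAct ((ℛ k f).left i) x * α.dualAct ((ℛ k f).right i) y := by
  induction x using Ambient.induction with
  | h0 => simp
  | hadd x x' hx hx' => simp only [map_add, add_mul, hx, hx', Finset.sum_add_distrib]
  | hmk a h =>
  induction y using Ambient.induction with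
  | h0 => simp
  | hadd x x' hx hx' => simp only [map_add, mul_add, hx, hx', Finset.sum_add_distrib]
  | hmk b g =>
    have hr : ∀ (u : HDual k H) (g' : H), Ambient.mk α a (hitLeft k H u h) * Ambient.mk α b g' =
        ∑ i ∈ (ℛ k h).index, Ambient.mk α (a * α.act ((ℛ k h).left i) b)
          (hitLeft k H u ((ℛ k h).right i) * g') := by
      intro u g'
      exact Ambient.mk_mul_mk α a b (hitLeft k H u h) g'
        { index := (ℛ k h).index
          left := (ℛ k h).left
          right := fun i => hitLeft k H u ((ℛ k h).right i)
          eq := by rw [comul_hitLeft, ← (ℛ k h).eq]; simp }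
    simp only [dualAct_mk, hr]
    rw [Ambient.mk_mul_mk α a b h g (ℛ k h), Finset.sum_comm]
    simp only [map_sum, dualAct_mk, hitLeft_mul]
    refine Finset.sum_congr rfl fun i _ => ?_
    exact TensorProduct.tmul_sum _ _ _

variable [Module.Finite k H] [Module.Projective k H]

/-- The associative, in general non-unital, algebra `(A ⊗ H) # H^*` with product
`(x # f)(y # g) = ∑ x (f₁ ▷ y) # f₂ * g`; explicitly
`(a ⊗ h # f)(b ⊗ g # l) = ∑ a (h₁ · b) ⊗ h₂ (f₁ ⇀ g) # f₂ * l`. -/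
def Double (_α : PartialHopfAction k H A) : Type _ := _α.Ambient ⊗[k] HDual k H

instance : AddCommGroup α.Double := inferInstanceAs (AddCommGroup (α.Ambient ⊗[k] HDual k H))
instance : Module k α.Double := inferInstanceAs (Module k (α.Ambient ⊗[k] HDual k H))

/-- The element `a ⊗ h # f`. -/
def Double.mk (a : A) (h : H) (f : HDual k H) : α.Double :=
  (Ambient.mk α a h ⊗ₜ[k] f : α.Ambient ⊗[k] HDual k H)

instance : NonUnitalRing α.Double where
  __ := (inferInstance : AddCommGroup α.Double)
  mul x y := smashMul α.dualAct x y
  left_distrib x y z := map_add (smashMul α.dualAct x) y z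
  right_distrib x y z := LinearMap.map_add₂ (smashMul α.dualAct) x y z
  zero_mul x := LinearMap.map_zero₂ (smashMul α.dualAct) x
  mul_zero x := map_zero (smashMul α.dualAct x)
  mul_assoc := smashMul_assoc α.dualAct α.dualAct_mul
    (fun f g x y => by simp only [dualAct_dualAct])

instance : IsScalarTower k α.Double α.Double :=
  ⟨fun c x y => LinearMap.map_smul₂ (smashMul α.dualAct) c x y⟩

instance : SMulCommClass k α.Double α.Double :=
  ⟨fun c x y => (map_smul (smashMul α.dualAct x) c y).symm⟩

/-- `(A # H) # H^*` inside `(A ⊗ H) # H^*`, where `A # H` is the partial smash product: the span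
of all `x # f` with `x ∈ A # H` and `f ∈ H^*`. -/
def partialDouble : Submodule k α.Double :=
  LinearMap.range (TensorProduct.map α.partialSmash.subtype
    (LinearMap.id : HDual k H →ₗ[k] HDual k H))

/-- `ψ(h # f) = 1 ⊗ λ(h # f)`. -/
def psi (A : Type*) [Ring A] [Algebra k A] :
    H ⊗[k] HDual k H →ₗ[k] A ⊗[k] Module.End k H :=
  TensorProduct.mk k A (Module.End k H) 1 ∘ₗ lam k H

/-- `φ(a) = ∑ᵢ (bᵢ · a) ⊗ ρ(S⁻¹(pᵢ) # 1)`. -/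
def phi (Sinv : HDual k H → HDual k H) {n : ℕ} (b : Fin n → H) (p : Fin n → HDual k H) (a : A) :
    A ⊗[k] Module.End k H :=
  ∑ i, α.act (b i) a ⊗ₜ[k] rho k H (Sinv (p i) ⊗ₜ[k] 1)

end PartialHopfAction

end HopfDuality

end

open HopfDuality

/-! Bijectivity of the antipode holds for every finitely generated projective Hopf algebra
(Pareigis). Trace-like sums over a dual basis give left integrals lⱼ of H^* and right integrals tⱼ
of H with ∑ lⱼ(tⱼ) = 1. For T(x) = ∑ⱼ lⱼ(· x) ⇀ tⱼ the two integral properties yield ∑ T(x₂) x₁ =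
ε(x) (`exists_sum_mul_eq_counit`). Applying S makes S ∘ T a right convolution inverse of S, so S ∘ T
= id. A surjective endomorphism of a finitely generated module is bijective, and transposing passes
to H^*.

For Φ, put Θ(F) = ∑ F(bᵢ) ⊗ ρ(S⁻¹(pᵢ) # 1). Since S⁻¹ turns the anti-multiplicative f ↦ ρ(f # 1)
into a multiplicative map, Θ is multiplicative on the convolution algebra Hom(H, A) (`dualSum_mul`).
As φ(a) = Θ(h ↦ h · a), the axioms of a partial action become φ(ac) = φ(a)φ(c) and φ(h · a) = φ(1)
Θ(g ↦ (gh) · a). Moving ψ(h # 1) to the right past φ(c) creates the elements Θ(g ↦ (g h₁) · c)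
without the factor φ(1); a factor φ(a) = φ(a)φ(1) standing on the left supplies it. This is
`phi_mul_psi_mul_phi`. Since ψ(1 # f) commutes with φ and ψ respects the products of the Heisenberg
double, Φ is multiplicative. The case c = 1 shows that ((a ⊗ h)(1 ⊗ 1)) # f goes to φ(a) ψ(h # f)
φ(1), which lies in the corner of e = φ(1). -/

noncomputable section

namespace HopfDuality

open Coalgebra HopfAlgebra

/-! ### Separation of points by the dual -/

section DualBasisLemmas

variable {k H : Type*} [CommRing k] [Ring H] [HopfAlgebra k H]
  {ι : Type*} [Fintype ι] {b : ι → H} {p : ι → HDual k H}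

theorem HDual.sum_apply_smul (hbp : ∀ h, ∑ i, (p i).ofConv h • b i = h) (f : HDual k H) :
    ∑ i, f.ofConv (b i) • p i = f := by
  ext x
  conv_rhs => rw [← hbp x]
  simp [mul_comm]

variable [Module.Finite k H] [Module.Projective k H]

theorem eq_of_dual_apply_eq {x y : H} (h : ∀ f : HDual k H, f.ofConv x = f.ofConv y) : x = y := by
  obtain ⟨n, b, p, hbp⟩ := exists_dualBasis k H
  rw [← hbp x, ← hbp y]
  exact Finset.sum_congr rfl fun i _ => by rw [show p i x = p i y from h (toConv (p i))]

theorem eq_of_dual_tensor_apply_eq {s t : H ⊗[k] H}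
    (h : ∀ f g : HDual k H, LinearMap.mul' k k (TensorProduct.map f.ofConv g.ofConv s) =
      LinearMap.mul' k k (TensorProduct.map f.ofConv g.ofConv t)) : s = t := by
  obtain ⟨n, b, p, hbp⟩ := exists_dualBasis k H
  have key : ∀ u : H ⊗[k] H, u = ∑ i, ∑ j,
      LinearMap.mul' k k (TensorProduct.map (p i) (p j) u) • (b i ⊗ₜ[k] b j) := by
    intro u
    induction u with
    | zero => simp
    | add u v hu hv =>
      conv_lhs => rw [hu, hv]
      simp only [map_add, add_smul, Finset.sum_add_distrib]
    | tmul x y =>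
      conv_lhs => rw [← hbp x, ← hbp y]
      simp only [TensorProduct.sum_tmul, TensorProduct.tmul_sum, TensorProduct.smul_tmul_smul,
        TensorProduct.map_tmul, LinearMap.mul'_apply]
      rw [Finset.sum_comm]
  rw [key s, key t]
  refine Finset.sum_congr rfl fun i _ => Finset.sum_congr rfl fun j _ => ?_
  rw [show LinearMap.mul' k k (TensorProduct.map (p i) (p j) s) = _ from
    h (toConv (p i)) (toConv (p j))]

end DualBasisLemmas

/-! ### Cancellation by coassociativity -/

section Sweedler

variable {k H M N : Type*} [CommRing k] [AddCommGroup H] [Module k H] [Coalgebra k H]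
  [AddCommGroup M] [Module k M] [AddCommGroup N] [Module k N]

/-- If `∑ B(x₁, x₂) = ε(x) m`, then `∑ C(B(x₁, x₂), x₃) = C(m, x)`. -/
theorem sum_sum_apply_of_sum_eq_counit (B : H →ₗ[k] H →ₗ[k] M) (C : M →ₗ[k] H →ₗ[k] N) (m : M)
    (hB : ∀ x, ∑ i ∈ (ℛ k x).index, B ((ℛ k x).left i) ((ℛ k x).right i) =
      counit (R := k) x • m) (x : H) :
    ∑ i ∈ (ℛ k x).index, ∑ j ∈ (ℛ k ((ℛ k x).right i)).index,
      C (B ((ℛ k x).left i) ((ℛ k ((ℛ k x).right i)).left j))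
        ((ℛ k ((ℛ k x).right i)).right j) = C m x := by
  have h := congrArg (TensorProduct.lift C ∘ₗ (TensorProduct.lift B).rTensor H ∘ₗ
    (TensorProduct.assoc k H H H).symm.toLinearMap)
      (Coalgebra.sum_tmul_tmul_eq (ℛ k x) (fun i => ℛ k _) (fun i => ℛ k _))
  simp only [map_sum, LinearMap.comp_apply, LinearEquiv.coe_coe, TensorProduct.assoc_symm_tmul,
    LinearMap.rTensor_tmul, TensorProduct.lift.tmul] at h
  rw [← h]
  conv_rhs => rw [← Coalgebra.sum_counit_smul (ℛ k x), map_sum]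
  refine Finset.sum_congr rfl fun i _ => ?_
  rw [← LinearMap.sum_apply, ← map_sum, hB]
  simp

end Sweedler

/-! ### Shifts of linear forms, and the antipode as a coalgebra antihomomorphism -/

section Antipode

variable {k H : Type*} [CommRing k] [Ring H] [HopfAlgebra k H]

/-- The left action `(x, f) ↦ f(· x)` of `H` on `H^*`. -/
def HDual.rightShift : H →ₗ[k] HDual k H →ₗ[k] HDual k H :=
  LinearMap.mk₂ k (fun x f => toConv (f.ofConv ∘ₗ LinearMap.mulRight k x))
    (fun x y f => by ext; simp [mul_add]) (fun c x f => by ext; simp)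
    (fun x f g => by ext; simp) (fun c x f => by ext; simp)

@[simp] theorem HDual.rightShift_apply (f : HDual k H) (x y : H) :
    (HDual.rightShift x f).ofConv y = f.ofConv (y * x) := by simp [HDual.rightShift]

theorem HDual.rightShift_rightShift (f : HDual k H) (x y : H) :
    HDual.rightShift x (HDual.rightShift y f) = HDual.rightShift (x * y) f := by
  ext; simp [mul_assoc]

@[simp] theorem HDual.rightShift_one (f : HDual k H) :
    HDual.rightShift 1 f = f := by
  ext; simp

theorem HDual.rightShift_mul (f g : HDual k H) (x : H) {ι : Type*} (r : Repr k x ι) :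
    HDual.rightShift x (f * g) = ∑ i ∈ r.index,
      HDual.rightShift (r.left i) f * HDual.rightShift (r.right i) g := by
  ext y
  rw [HDual.rightShift_apply, Repr.convMul_apply ((ℛ k y).mul r)]
  simp only [ofConv_sum, LinearMap.sum_apply, (ℛ k y).convMul_apply]
  simp [Coalgebra.Repr.mul, Coalgebra.Repr.induced, Coalgebra.Repr.tmul, Finset.sum_product_right]

theorem HDual.mulShift_mul (f g : HDual k H) (x : H) {ι : Type*} (r : Repr k x ι) :
    (f * g).mulShift x = ∑ i ∈ r.index, f.mulShift (r.left i) * g.mulShift (r.right i) := by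
  ext y
  rw [HDual.mulShift_apply, Repr.convMul_apply (r.mul (ℛ k y))]
  simp only [ofConv_sum, LinearMap.sum_apply, (ℛ k y).convMul_apply]
  simp [Coalgebra.Repr.mul, Coalgebra.Repr.induced, Coalgebra.Repr.tmul, Finset.sum_product]

theorem HDual.apply_hitLeft (f g : HDual k H) (x : H) :
    g.ofConv (hitLeft k H f x) = (g * f).ofConv x := by
  rw [hitLeft_apply f x (ℛ k x), (ℛ k x).convMul_apply]
  simp [mul_comm]

theorem HDual.apply_hitRight (f g : HDual k H) (x : H) :
    g.ofConv (hitRight k H x f) = (f * g).ofConv x := by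
  rw [hitRight_apply f x (ℛ k x), (ℛ k x).convMul_apply]
  simp

variable [Module.Finite k H] [Module.Projective k H]

/-- `Δ(S(x)) = ∑ S(x₂) ⊗ S(x₁)`. -/
def reprAntipode {x : H} {ι : Type*} (r : Repr k x ι) : Repr k (antipode k x) ι where
  index := r.index
  left i := antipode k (r.right i)
  right i := antipode k (r.left i)
  eq := by
    apply eq_of_dual_tensor_apply_eq
    intro f g
    -- Tested against f ⊗ g, the claim is the anti-multiplicativity of the antipode of H^*,
    -- evaluated at x.
    have h : (f * g).ofConv (antipode k x) = (antipode k g * antipode k f).ofConv x := by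
      rw [← HDual.antipode_apply, antipode_mul_antidistrib]
    rw [r.convMul_apply] at h
    refine Eq.trans ?_ h.symm
    simp [mul_comm]

end Antipode

/-! ### Integrals in H and H^* from a dual basis -/

section Integrals

variable {k H : Type*} [CommRing k] [Ring H] [HopfAlgebra k H]

theorem sum_antipode_antipode_mul_antipode (x : H) :
    ∑ i ∈ (ℛ k x).index, antipode k (antipode k ((ℛ k x).right i)) *
      antipode k ((ℛ k x).left i) = counit (R := k) x • 1 := by
  simp only [← antipode_mul_antidistrib, ← map_sum, sum_mul_antipode_eq_smul (ℛ k x)]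
  simp

section

variable {ι : Type*} [Fintype ι] (b : ι → H) (p : ι → HDual k H)

/-- The form `∑ᵢ (pᵢ * f)(· S²(bᵢ))`, which is a left integral of `H^*`; see
`mul_leftIntegral`. -/
def leftIntegral (f : HDual k H) : HDual k H :=
  ∑ l, HDual.rightShift (antipode k (antipode k (b l))) (p l * f)

variable {b p}

/-- Multiplication of H^* is dual to Δ: comultiplying the first leg of ∑ bₗ ⊗ pₗ amounts to
multiplying the second legs of two copies. -/
theorem sum_comul_dualBasis (hbp : ∀ h, ∑ i, (p i).ofConv h • b i = h)
    {M : Type*} [AddCommGroup M] [Module k M] (F : H →ₗ[k] H →ₗ[k] HDual k H →ₗ[k] M) :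
    ∑ l, ∑ a ∈ (ℛ k (b l)).index, F ((ℛ k (b l)).left a) ((ℛ k (b l)).right a) (p l) =
      ∑ i, ∑ j, F (b i) (b j) (p i * p j) := by
  have e : ∀ i j, F (b i) (b j) (p i * p j) = ∑ l, ∑ a ∈ (ℛ k (b l)).index,
      F ((p i).ofConv ((ℛ k (b l)).left a) • b i) ((p j).ofConv ((ℛ k (b l)).right a) • b j)
        (p l) := by
    intro i j
    conv_lhs => rw [← HDual.sum_apply_smul hbp (p i * p j)]
    simp [(ℛ k _).convMul_apply, Finset.sum_smul, mul_smul, smul_comm ((p j).ofConv _)]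
  simp only [e]
  rw [Finset.sum_congr rfl fun j _ => Finset.sum_comm, Finset.sum_comm]
  refine Finset.sum_congr rfl fun l _ => ?_
  rw [Finset.sum_congr rfl fun j _ => Finset.sum_comm, Finset.sum_comm]
  refine Finset.sum_congr rfl fun a _ => ?_
  simp only [← LinearMap.sum_apply, ← map_sum, hbp]

/-- At y the left side collapses to g(∑ y₁ S(y₂)), because ∑ pᵢ(y₂) bᵢ = y₂. -/
theorem sum_rightShift_antipode_mul (hbp : ∀ h, ∑ i, (p i).ofConv h • b i = h)
    (g : HDual k H) :
    ∑ i, HDual.rightShift (antipode k (b i)) g * p i = g.ofConv 1 • 1 := by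
  ext y
  have h : ∀ x : H × H, g.ofConv (x.1 * antipode k x.2) = ∑ i,
      g.ofConv (x.1 * antipode k (b i)) * (p i).ofConv x.2 := by
    intro x
    conv_lhs => rw [← hbp x.2]
    simp [Finset.mul_sum, mul_comm]
  have h2 := congrArg g.ofConv (sum_mul_antipode_eq_smul (R := k) (ℛ k y))
  rw [map_sum, Finset.sum_congr rfl fun i _ => h ((ℛ k y).left i, (ℛ k y).right i),
    Finset.sum_comm] at h2
  simp only [ofConv_sum, LinearMap.sum_apply, (ℛ k y).convMul_apply, HDual.rightShift_apply]
  simpa [mul_comm] using h2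

/-- A right integral t absorbs each S²(bₗ) as ε(bₗ), and ∑ ε(bₗ) pₗ is the unit of H^*. So pairing
integrals reduces to evaluating f. -/
theorem leftIntegral_apply_of_mul_eq (hbp : ∀ h, ∑ i, (p i).ofConv h • b i = h)
    (f : HDual k H) (t : H) (ht : ∀ x, t * x = counit (R := k) x • t) :
    (leftIntegral b p f).ofConv t = f.ofConv t := by
  have h : ∑ i, counit (R := k) (b i) • p i = 1 := by
    simpa using HDual.sum_apply_smul hbp (1 : HDual k H)
  conv_rhs => rw [← one_mul f, ← h]
  simp [leftIntegral, ht, Finset.sum_mul]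

end

variable [Module.Finite k H] [Module.Projective k H]

theorem HDual.rightShift_antipode_antipode (p : HDual k H) (x : H) :
    HDual.rightShift x (antipode k (antipode k p)) =
      antipode k (antipode k (HDual.rightShift (antipode k (antipode k x)) p)) := by
  ext y
  simp [antipode_mul_antidistrib]

/-- Writing x · f for f(· x), the element x₂ acts diagonally on the product and x · S²(p) = S²(S²(x)
· p). The leftover S²(x₂) S(x₁) cancels to ε. -/
theorem HDual.antipode_antipode_mul_rightShift (p g : HDual k H) (x : H) :
    antipode k (antipode k p) * HDual.rightShift x g = ∑ i ∈ (ℛ k x).index,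
      HDual.rightShift ((ℛ k x).right i)
        (antipode k (antipode k (HDual.rightShift (antipode k ((ℛ k x).left i)) p)) * g) := by
  have h := sum_sum_apply_of_sum_eq_counit (k := k)
    ((((LinearMap.mul k H).flip.compl₁₂ (antipode k) (antipode k ∘ₗ antipode k)).compr₂
      (antipode k ∘ₗ antipode k ∘ₗ HDual.rightShift.flip p)))
    ((LinearMap.mul k (HDual k H)).compl₁₂ LinearMap.id (HDual.rightShift.flip g))
    (antipode k (antipode k p)) ?_ x
  · simp only [LinearMap.compl₁₂_apply, LinearMap.compr₂_apply, LinearMap.comp_apply,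
      LinearMap.flip_apply, LinearMap.mul_apply', LinearMap.id_apply] at h
    rw [← h]
    refine Finset.sum_congr rfl fun i _ => ?_
    rw [HDual.rightShift_mul _ _ _ (ℛ k _)]
    simp only [HDual.rightShift_antipode_antipode, HDual.rightShift_rightShift]
  · intro x
    simp only [LinearMap.compl₁₂_apply, LinearMap.compr₂_apply, LinearMap.comp_apply,
      LinearMap.flip_apply, LinearMap.mul_apply', ← map_sum, ← LinearMap.sum_apply,
      sum_antipode_antipode_mul_antipode]
    simp

variable {ι : Type*} [Fintype ι] (b : ι → H) (p : ι → HDual k H)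

/-- An element `∑ᵢ (h bᵢ) ↼ S²(pᵢ)`, which is a right integral of `H`; see
`rightIntegral_mul`. -/
def rightIntegral (h : H) : H :=
  ∑ i, hitRight k H (h * b i) (antipode k (antipode k (p i)))

theorem HDual.apply_rightIntegral (g : HDual k H) (h : H) :
    g.ofConv (rightIntegral b p h) =
      ∑ i, (antipode k (antipode k (p i)) * g).ofConv (h * b i) := by
  simp only [rightIntegral, map_sum, HDual.apply_hitRight]

variable {b p}

theorem rightIntegral_mul (hbp : ∀ h, ∑ i, (p i).ofConv h • b i = h) (h x : H) :
    rightIntegral b p h * x = counit (R := k) x • rightIntegral b p h := by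
  apply eq_of_dual_apply_eq (k := k)
  intro g
  -- Invariance of the canonical element: right multiplication by z on bᵢ can be traded for the
  -- shift of pᵢ by z.
  have hb : ∀ (y z : H), ∑ i, (antipode k (antipode k (HDual.rightShift y (p i))) * g).ofConv
      (h * b i * z) = ∑ i, (antipode k (antipode k (HDual.rightShift (y * z) (p i))) * g).ofConv
      (h * b i) := by
    intro y z
    have e : ∀ i, HDual.rightShift y (HDual.rightShift z (p i)) =
        ∑ j, (p i).ofConv (b j * z) • HDual.rightShift y (p j) := by
      intro i
      conv_lhs => rw [← HDual.sum_apply_smul hbp (HDual.rightShift z (p i))]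
      simp
    have e' : ∀ j, h * b j * z = ∑ i, (p i).ofConv (b j * z) • (h * b i) := by
      intro j
      conv_lhs => rw [mul_assoc, ← hbp (b j * z)]
      simp [Finset.mul_sum]
    simp only [← HDual.rightShift_rightShift, e, e', map_sum, map_smul, Finset.sum_mul,
      smul_mul_assoc, ofConv_sum, ofConv_smul, LinearMap.sum_apply, LinearMap.smul_apply]
    rw [Finset.sum_comm]
  rw [← HDual.rightShift_apply, HDual.apply_rightIntegral, map_smul, HDual.apply_rightIntegral]
  simp only [HDual.antipode_antipode_mul_rightShift, ofConv_sum, LinearMap.sum_apply,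
    HDual.rightShift_apply]
  rw [Finset.sum_comm]
  simp only [hb]
  rw [Finset.sum_comm, Finset.smul_sum]
  refine Finset.sum_congr rfl fun i _ => ?_
  -- After the trade the shift is by S(x₁) x₂, which sums to ε(x).
  have := congrArg (fun u => (antipode k (antipode k (HDual.rightShift u (p i))) * g).ofConv
    (h * b i)) (sum_antipode_mul_eq_smul (R := k) (ℛ k x))
  simpa [Finset.sum_mul] using this

/-- This normalises the integrals: expanding in the dual basis leaves ∑ pₗ(S(bₗ₂) S²(bₗ₁)) = ∑
pₗ(S(S(bₗ₁) bₗ₂)) = ∑ ε(bₗ) pₗ(1) = ε(1). -/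
theorem sum_apply_antipode_rightIntegral (hbp : ∀ h, ∑ i, (p i).ofConv h • b i = h) :
    ∑ j, (antipode k (p j)).ofConv (rightIntegral b p (b j)) = 1 := by
  have e : ∀ i j, (antipode k (antipode k (p i)) * antipode k (p j)).ofConv (b j * b i) =
      ∑ l, (p l).ofConv (b j * b i) * ∑ a ∈ (ℛ k (b l)).index,
        (p i).ofConv (antipode k (antipode k ((ℛ k (b l)).left a))) *
          (p j).ofConv (antipode k ((ℛ k (b l)).right a)) := by
    intro i j
    conv_lhs => rw [← hbp (b j * b i), map_sum]
    simp only [map_smul, smul_eq_mul]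
    simp only [(ℛ k _).convMul_apply, HDual.antipode_apply]
  have e2 : ∀ (l : ι) (x y : H), ∑ j, ∑ i, (p l).ofConv (b j * b i) *
      ((p i).ofConv y * (p j).ofConv x) = (p l).ofConv (x * y) := by
    intro l x y
    conv_rhs => rw [← hbp x, ← hbp y]
    simp only [Finset.sum_mul_sum, smul_mul_smul_comm, map_sum, map_smul, smul_eq_mul]
    exact Finset.sum_congr rfl fun i _ => Finset.sum_congr rfl fun j _ => by ring
  simp only [HDual.apply_rightIntegral, e]
  calc _ = ∑ l, ∑ a ∈ (ℛ k (b l)).index, ∑ j, ∑ i, (p l).ofConv (b j * b i) *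
        ((p i).ofConv (antipode k (antipode k ((ℛ k (b l)).left a))) *
          (p j).ofConv (antipode k ((ℛ k (b l)).right a))) := by
        rw [Finset.sum_congr rfl fun j _ => Finset.sum_comm, Finset.sum_comm]
        refine Finset.sum_congr rfl fun l _ => ?_
        simp only [Finset.mul_sum]
        rw [Finset.sum_congr rfl fun j _ => Finset.sum_comm, Finset.sum_comm]
    _ = ∑ l, (p l).ofConv (counit (R := k) (b l) • 1) := by
        refine Finset.sum_congr rfl fun l _ => ?_
        simp only [e2, ← antipode_mul_antidistrib, ← map_sum, sum_antipode_mul_eq_smul (ℛ k (b l))]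
        simp
    _ = counit (R := k) (∑ l, (p l).ofConv 1 • b l) := by simp [mul_comm]
    _ = 1 := by rw [hbp]; simp

theorem HDual.mul_rightShift_antipode_antipode (g u : HDual k H) (c : H) :
    g * HDual.rightShift (antipode k (antipode k c)) u = ∑ i ∈ (ℛ k c).index,
      HDual.rightShift (antipode k (antipode k ((ℛ k c).right i)))
        (HDual.rightShift (antipode k ((ℛ k c).left i)) g * u) := by
  have h := sum_sum_apply_of_sum_eq_counit (k := k)
    ((((LinearMap.mul k H).flip.compl₁₂ (antipode k) (antipode k ∘ₗ antipode k)).compr₂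
      (HDual.rightShift.flip g)))
    ((LinearMap.mul k (HDual k H)).compl₁₂ LinearMap.id
      (HDual.rightShift.flip u ∘ₗ antipode k ∘ₗ antipode k)) g ?_ c
  · simp only [LinearMap.compl₁₂_apply, LinearMap.compr₂_apply, LinearMap.comp_apply,
      LinearMap.flip_apply, LinearMap.mul_apply', LinearMap.id_apply] at h
    rw [← h]
    refine Finset.sum_congr rfl fun i _ => ?_
    -- S² preserves the order of the tensor factors, since the two flips cancel.
    rw [HDual.rightShift_mul _ _ _ (reprAntipode (reprAntipode (ℛ k _)))]
    simp only [HDual.rightShift_rightShift, reprAntipode]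
  · intro x
    simp only [LinearMap.compl₁₂_apply, LinearMap.compr₂_apply, LinearMap.comp_apply,
      LinearMap.flip_apply, LinearMap.mul_apply', ← map_sum, ← LinearMap.sum_apply,
      sum_antipode_antipode_mul_antipode]
    simp

/-- Pulling g inside the shift by S²(bₗ) splits bₗ by Δ; `sum_comul_dualBasis` turns this into a
product pᵢ * pⱼ, and the sum over i then collapses to g(1). -/
theorem mul_leftIntegral (hbp : ∀ h, ∑ i, (p i).ofConv h • b i = h) (g f : HDual k H) :
    g * leftIntegral b p f = g.ofConv 1 • leftIntegral b p f := by
  have h := sum_comul_dualBasis hbp (M := HDual k H)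
    (LinearMap.mk₂ k (fun x y =>
      HDual.rightShift (antipode k (antipode k y)) ∘ₗ
        LinearMap.mulLeft k (HDual.rightShift (antipode k x) g) ∘ₗ LinearMap.mulRight k f)
      (fun x x' y => by ext : 1; simp [add_mul])
      (fun c x y => by
        ext u : 1
        simp only [map_smul, LinearMap.smul_apply, LinearMap.comp_apply, LinearMap.mulLeft_apply]
        rw [smul_mul_assoc, map_smul])
      (fun x y y' => by ext : 1; simp) (fun c x y => by ext : 1; simp))
  simp only [LinearMap.mk₂_apply, LinearMap.comp_apply, LinearMap.mulLeft_apply,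
    LinearMap.mulRight_apply] at h
  simp only [leftIntegral, Finset.mul_sum, HDual.mul_rightShift_antipode_antipode, h]
  rw [Finset.sum_comm, Finset.smul_sum]
  refine Finset.sum_congr rfl fun j _ => ?_
  simp only [mul_assoc]
  simp only [← mul_assoc (HDual.rightShift _ g), ← map_sum, ← Finset.sum_mul,
    sum_rightShift_antipode_mul hbp]
  simp

end Integrals

/-! ### Bijectivity of the antipode -/

section Bijective

variable (k H : Type*) [CommRing k] [Ring H] [HopfAlgebra k H]
  [Module.Finite k H] [Module.Projective k H]

theorem exists_sum_mul_eq_counit : ∃ T : H →ₗ[k] H, ∀ x : H,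
    ∑ i ∈ (ℛ k x).index, T ((ℛ k x).right i) * (ℛ k x).left i = counit (R := k) x • 1 := by
  obtain ⟨n, b, p', hbp'⟩ := exists_dualBasis k H
  obtain ⟨p, rfl⟩ : ∃ p : Fin n → HDual k H, p' = fun i => (p i).ofConv :=
    ⟨fun i => toConv (p' i), rfl⟩
  have hbp : ∀ h, ∑ i, (p i).ofConv h • b i = h := hbp'
  -- Over a general k the integrals need not form a free module, so a family of pairs with ∑ lⱼ(tⱼ)
  -- = 1 replaces a single normalised pair.
  let t := fun j => rightIntegral b p (b j)
  let l := fun j => leftIntegral b p (antipode k (p j))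
  have ht : ∀ j x, t j * x = counit (R := k) x • t j := fun j x => rightIntegral_mul hbp _ x
  have hl : ∀ j (g : HDual k H), g * l j = g.ofConv 1 • l j :=
    fun j g => mul_leftIntegral hbp g _
  have hlt : ∑ j, (l j).ofConv (t j) = 1 := by
    rw [← sum_apply_antipode_rightIntegral hbp]
    exact Finset.sum_congr rfl fun j _ => leftIntegral_apply_of_mul_eq hbp _ _ (ht j)
  refine ⟨∑ j, (hitLeft k H).flip (t j) ∘ₗ HDual.rightShift.flip (l j), fun x => ?_⟩
  apply eq_of_dual_apply_eq (k := k)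
  intro g
  have e : ∀ j, ∑ i ∈ (ℛ k x).index,
      g.ofConv (hitLeft k H (HDual.rightShift ((ℛ k x).right i) (l j)) (t j) * (ℛ k x).left i) =
        g.ofConv 1 * counit (R := k) x * (l j).ofConv (t j) := by
    intro j
    -- Evaluate the shift of g * l by x at t: one integral property gives g * l = g(1) l, the other
    -- t x = ε(x) t.
    have h := congrArg (fun f : HDual k H => f.ofConv (t j))
      (HDual.rightShift_mul g (l j) x (ℛ k x))
    simp only [hl, HDual.rightShift_apply, ht, ofConv_sum, LinearMap.sum_apply] at h
    simp only [← HDual.rightShift_apply g, HDual.apply_hitLeft, ← h]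
    simp [mul_assoc, mul_left_comm]
  simp only [LinearMap.sum_apply, LinearMap.comp_apply, LinearMap.flip_apply, map_sum,
    Finset.sum_mul]
  rw [Finset.sum_comm]
  simp only [e, ← Finset.mul_sum, hlt]
  simp [mul_comm]

theorem antipode_bijective :
    Function.Bijective (antipode k : H →ₗ[k] H) := by
  obtain ⟨T, hT⟩ := exists_sum_mul_eq_counit k H
  have h : toConv (antipode k (A := H)) * toConv (antipode k ∘ₗ T) = 1 := by
    ext x
    rw [(ℛ k x).convMul_apply]
    have := congrArg (antipode k) (hT x)
    simpa [antipode_mul_antidistrib, Algebra.algebraMap_eq_smul_one] using this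
  -- The identity is a left convolution inverse of S, so it equals the right inverse S ∘ T, and S is
  -- onto.
  have h' := left_inv_eq_right_inv (LinearMap.id_mul_antipode (R := k) (C := H)) h
  refine OrzechProperty.bijective_of_surjective_endomorphism _ fun x => ⟨T x, ?_⟩
  exact (LinearMap.congr_fun (congrArg ofConv h') x).symm

theorem antipode_bijective_dual :
    Function.Bijective (antipode k : HDual k H →ₗ[k] HDual k H) := by
  obtain ⟨hi, hs⟩ := antipode_bijective k H
  let e := LinearEquiv.ofBijective (antipode k : H →ₗ[k] H) ⟨hi, hs⟩
  refine ⟨fun f g h => ?_, fun f => ⟨toConv (f.ofConv ∘ₗ e.symm.toLinearMap), ?_⟩⟩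
  · ext x
    obtain ⟨y, rfl⟩ := hs x
    exact congrArg (fun u : HDual k H => u.ofConv y) h
  · ext x
    exact congrArg f.ofConv (e.symm_apply_apply x)

end Bijective

/-! ### Commutation rules for the operators λ and ρ -/

section Heisenberg

variable {k H : Type*} [CommRing k] [Ring H] [HopfAlgebra k H]

@[simp] theorem hitLeft_one (x : H) : hitLeft k H 1 x = x := by
  have h : (1 : HDual k H).ofConv = counit (R := k) := by
    ext
    simp
  simp [hitLeft, h]

theorem lam_tmul_eq_mul (h : H) (f : HDual k H) :
    lam k H (h ⊗ₜ f) = lam k H (h ⊗ₜ 1) * lam k H (1 ⊗ₜ f) := by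
  ext x
  simp [Module.End.mul_apply]

theorem lam_mul_tmul (h g : H) (f : HDual k H) :
    lam k H (h ⊗ₜ 1) * lam k H (g ⊗ₜ f) = lam k H ((h * g) ⊗ₜ f) := by
  ext x
  simp [Module.End.mul_apply, mul_assoc]

/-- The right action `(x, f) ↦ f(x ·)` of `H` on `H^*`. -/
def HDual.leftShift : H →ₗ[k] HDual k H →ₗ[k] HDual k H :=
  LinearMap.mk₂ k (fun x f => f.mulShift x)
    (fun x y f => by ext; simp [add_mul]) (fun c x f => by ext; simp)
    (fun x f g => by ext; simp) (fun c x f => by ext; simp)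

@[simp] theorem HDual.leftShift_apply (x : H) (f : HDual k H) :
    HDual.leftShift x f = f.mulShift x := rfl

variable [Module.Finite k H] [Module.Projective k H]

theorem hitRight_hitRight (f g : HDual k H) (x : H) :
    hitRight k H (hitRight k H x f) g = hitRight k H x (f * g) := by
  apply eq_of_dual_apply_eq (k := k)
  intro u
  simp only [HDual.apply_hitRight, mul_assoc]

theorem hitLeft_hitRight (f g : HDual k H) (x : H) :
    hitLeft k H f (hitRight k H x g) = hitRight k H (hitLeft k H f x) g := by
  apply eq_of_dual_apply_eq (k := k)
  intro u
  simp only [HDual.apply_hitRight, HDual.apply_hitLeft, mul_assoc]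

/-- Δ(h₂ x) contributes h₂ x₁ to the argument of q, where S(h₁) h₂ cancels, leaving h q(x₁) x₂. -/
theorem mul_hitRight (h x : H) (q : HDual k H) :
    h * hitRight k H x q = ∑ i ∈ (ℛ k h).index,
      hitRight k H ((ℛ k h).right i * x) (q.mulShift (antipode k ((ℛ k h).left i))) := by
  apply eq_of_dual_apply_eq (k := k)
  intro g
  have hs := sum_sum_apply_of_sum_eq_counit (k := k)
    (((LinearMap.mul k H).compl₁₂ (antipode k) LinearMap.id).compr₂ (HDual.leftShift.flip q))
    ((LinearMap.mul k (HDual k H)).compl₁₂ LinearMap.id (HDual.leftShift.flip g)) q ?_ h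
  · simp only [LinearMap.compl₁₂_apply, LinearMap.compr₂_apply, LinearMap.flip_apply,
      LinearMap.mul_apply', LinearMap.id_apply, HDual.leftShift_apply] at hs
    rw [← HDual.mulShift_apply, HDual.apply_hitRight, ← hs]
    simp only [map_sum, HDual.apply_hitRight, ofConv_sum, LinearMap.sum_apply]
    refine Finset.sum_congr rfl fun i _ => ?_
    rw [← HDual.mulShift_apply, HDual.mulShift_mul _ _ _ (ℛ k _), ofConv_sum, LinearMap.sum_apply]
    have e : ∀ u v : H, (q.mulShift u).mulShift v = q.mulShift (u * v) := by
      intro u v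
      ext y
      simp [mul_assoc]
    simp only [e]
  · intro y
    simp only [LinearMap.compl₁₂_apply, LinearMap.compr₂_apply, LinearMap.id_apply,
      LinearMap.mul_apply', ← map_sum, sum_antipode_mul_eq_smul (ℛ k y), map_smul]
    congr 1
    ext
    simp

theorem lam_mul_lam (g : H) (f l : HDual k H) :
    lam k H (1 ⊗ₜ f) * lam k H (g ⊗ₜ l) = ∑ i ∈ (ℛ k f).index,
      lam k H (hitLeft k H ((ℛ k f).left i) g ⊗ₜ ((ℛ k f).right i * l)) := by
  ext x
  simp [Module.End.mul_apply, hitLeft_mul, hitLeft_hitLeft]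

end Heisenberg

/-! ### The twisted operators ρ(S⁻¹(f) # 1) -/

section TwistedHit

variable {k H : Type*} [CommRing k] [Ring H] [HopfAlgebra k H]
  (Sinv : HDual k H ≃ₗ[k] HDual k H)

/-- The map `f ↦ ρ(S⁻¹(f) # 1)`. -/
def rhoInv : HDual k H →ₗ[k] Module.End k H :=
  rho k H ∘ₗ (TensorProduct.mk k (HDual k H) H).flip 1 ∘ₗ Sinv.toLinearMap

theorem rhoInv_eq (f : HDual k H) : rhoInv Sinv f = rho k H (Sinv f ⊗ₜ 1) := rfl

@[simp] theorem rhoInv_apply (f : HDual k H) (x : H) :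
    rhoInv Sinv f x = hitRight k H x (Sinv f) := by
  simp [rhoInv_eq]

variable [Module.Finite k H] [Module.Projective k H]

theorem lam_mul_rhoInv_comm (f g : HDual k H) :
    lam k H (1 ⊗ₜ f) * rhoInv Sinv g = rhoInv Sinv g * lam k H (1 ⊗ₜ f) := by
  ext x
  simp [Module.End.mul_apply, hitLeft_hitRight]

variable {Sinv} (hS : ∀ f, Sinv (antipode k f) = f)
include hS

/-- f ↦ ρ(f # 1) reverses products by `hitRight_hitRight`, and S⁻¹ reverses them back. -/
theorem rhoInv_mul (f g : HDual k H) : rhoInv Sinv (f * g) = rhoInv Sinv f * rhoInv Sinv g := by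
  have h : Sinv (f * g) = Sinv g * Sinv f := by
    have h' : ∀ f, antipode k (Sinv f) = f := fun f => by
      apply Sinv.injective
      rw [hS]
    rw [← hS (Sinv g * Sinv f), antipode_mul_antidistrib, h', h']
  ext x
  simp [Module.End.mul_apply, h, hitRight_hitRight]

theorem lam_mul_rhoInv (h : H) (f : HDual k H) :
    lam k H (h ⊗ₜ 1) * rhoInv Sinv f = ∑ i ∈ (ℛ k h).index,
      rhoInv Sinv (HDual.rightShift ((ℛ k h).left i) f) * lam k H ((ℛ k h).right i ⊗ₜ 1) := by
  -- S⁻¹ exchanges the left shift by S(y) with the right shift by y; the right shift is what matches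
  -- the term (g h) · a in the action axiom.
  have e : ∀ y, (Sinv f).mulShift (antipode k y) = Sinv (HDual.rightShift y f) := by
    intro y
    rw [← hS ((Sinv f).mulShift (antipode k y))]
    congr 1
    obtain ⟨g, rfl⟩ := Sinv.symm.surjective f
    rw [Sinv.apply_symm_apply]
    have : Sinv.symm g = antipode k g := by rw [Sinv.symm_apply_eq, hS]
    rw [this]
    ext z
    simp [antipode_mul_antidistrib]
  ext x
  simp [Module.End.mul_apply, mul_hitRight, e]

end TwistedHit

/-! ### The convolution algebra Hom(H, A) and the map φ -/

namespace PartialHopfAction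

variable {k H A : Type*} [CommRing k] [Ring H] [HopfAlgebra k H] [Ring A] [Algebra k A]

section Theta

variable {E : Type*} [Ring E] [Algebra k E] {ι : Type*} [Fintype ι]
  (R : HDual k H →ₗ[k] E) (b : ι → H) (p : ι → HDual k H)

/-- The element `∑ᵢ F(bᵢ) ⊗ R(pᵢ)` attached to a linear map `F : H → A`. -/
def dualSum (F : WithConv (H →ₗ[k] A)) : A ⊗[k] E := ∑ i, F.ofConv (b i) ⊗ₜ[k] R (p i)

variable {b p}

theorem dualSum_mul (hbp : ∀ h, ∑ i, (p i).ofConv h • b i = h)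
    (hR : ∀ f g, R (f * g) = R f * R g) (F G : WithConv (H →ₗ[k] A)) :
    dualSum R b p (F * G) = dualSum R b p F * dualSum R b p G := by
  have e : ∀ i j, R (p i) * R (p j) = ∑ l, (p i * p j).ofConv (b l) • R (p l) := by
    intro i j
    rw [← hR]
    conv_lhs => rw [← HDual.sum_apply_smul hbp (p i * p j)]
    simp
  have e2 : ∀ l, (F * G).ofConv (b l) = ∑ i, ∑ j,
      (p i * p j).ofConv (b l) • (F.ofConv (b i) * G.ofConv (b j)) := by
    intro l
    have e3 : ∀ x y : H, F.ofConv x * G.ofConv y = ∑ i, ∑ j,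
        ((p i).ofConv x * (p j).ofConv y) • (F.ofConv (b i) * G.ofConv (b j)) := by
      intro x y
      conv_lhs => rw [← hbp x, ← hbp y]
      simp only [map_sum, map_smul, Finset.sum_mul_sum, smul_mul_smul_comm]
    rw [(ℛ k (b l)).convMul_apply, Finset.sum_congr rfl fun a _ => e3 _ _, Finset.sum_comm]
    refine Finset.sum_congr rfl fun i _ => ?_
    rw [Finset.sum_comm]
    refine Finset.sum_congr rfl fun j _ => ?_
    rw [(ℛ k (b l)).convMul_apply, Finset.sum_smul]
  simp only [dualSum, Finset.sum_mul_sum, Algebra.TensorProduct.tmul_mul_tmul, e, e2,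
    TensorProduct.sum_tmul, TensorProduct.tmul_sum, TensorProduct.smul_tmul]
  rw [Finset.sum_comm]
  exact Finset.sum_congr rfl fun i _ => Finset.sum_comm

/-- The canonical element lets multiplication by h move from bᵢ to a shift of pᵢ, the form in which
`lam_mul_rhoInv` produces it. -/
theorem dualSum_comp_mulRight (hbp : ∀ h, ∑ i, (p i).ofConv h • b i = h)
    (F : WithConv (H →ₗ[k] A)) (h : H) :
    dualSum R b p (toConv (F.ofConv ∘ₗ LinearMap.mulRight k h)) =
      ∑ i, F.ofConv (b i) ⊗ₜ[k] R (HDual.rightShift h (p i)) := by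
  have e : ∀ i, R (HDual.rightShift h (p i)) = ∑ j, (p i).ofConv (b j * h) • R (p j) := by
    intro i
    conv_lhs => rw [← HDual.sum_apply_smul hbp (HDual.rightShift h (p i))]
    simp
  have e' : ∀ j, F.ofConv (b j * h) = ∑ i, (p i).ofConv (b j * h) • F.ofConv (b i) := by
    intro j
    conv_lhs => rw [← hbp (b j * h)]
    simp
  simp only [dualSum, LinearMap.comp_apply, LinearMap.mulRight_apply, e, e',
    TensorProduct.sum_tmul, TensorProduct.tmul_sum, TensorProduct.smul_tmul]
  exact Finset.sum_comm

end Theta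

variable (α : PartialHopfAction k H A)
  {n : ℕ} {b : Fin n → H} {p : Fin n → HDual k H} {Sinv : HDual k H ≃ₗ[k] HDual k H}

theorem phi_eq_dualSum (a : A) :
    α.phi Sinv b p a = dualSum (rhoInv Sinv) b p (toConv (α.act.flip a)) := rfl

variable [Module.Finite k H] [Module.Projective k H]

theorem psi_one_tmul_mul_phi (f : HDual k H) (a : A) :
    psi A (1 ⊗ₜ f) * α.phi Sinv b p a = α.phi Sinv b p a * psi A (1 ⊗ₜ f) := by
  simp only [phi_eq_dualSum, dualSum, psi, LinearMap.comp_apply, TensorProduct.mk_apply,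
    Finset.mul_sum, Finset.sum_mul, Algebra.TensorProduct.tmul_mul_tmul, one_mul, mul_one,
    lam_mul_rhoInv_comm]

variable (hbp : ∀ h, ∑ i, (p i).ofConv h • b i = h) (hS : ∀ f, Sinv (antipode k f) = f)
include hbp hS

theorem phi_mul (a c : A) :
    α.phi Sinv b p (a * c) = α.phi Sinv b p a * α.phi Sinv b p c := by
  simp only [phi_eq_dualSum]
  rw [← dualSum_mul _ hbp (rhoInv_mul hS)]
  congr 1
  ext h
  exact α.act_mul h a c

/-- The axiom for h · (g · a) is a convolution identity whose first factor is h ↦ h · 1; that factor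
becomes φ(1). -/
theorem phi_act (h : H) (a : A) :
    α.phi Sinv b p (α.act h a) = α.phi Sinv b p 1 *
      dualSum (rhoInv Sinv) b p (toConv (α.act.flip a ∘ₗ LinearMap.mulRight k h)) := by
  simp only [phi_eq_dualSum]
  rw [← dualSum_mul _ hbp (rhoInv_mul hS)]
  congr 1
  ext g
  exact α.act_act g h a

theorem psi_tmul_one_mul_phi (h : H) (a : A) :
    psi A (h ⊗ₜ 1) * α.phi Sinv b p a = ∑ i ∈ (ℛ k h).index,
      dualSum (rhoInv Sinv) b p (toConv (α.act.flip a ∘ₗ LinearMap.mulRight k ((ℛ k h).left i))) *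
        psi A ((ℛ k h).right i ⊗ₜ 1) := by
  have e := fun i => dualSum_comp_mulRight (rhoInv Sinv) hbp (toConv (α.act.flip a))
    ((ℛ k h).left i)
  simp only [e]
  simp only [phi, ← rhoInv_eq, psi, LinearMap.comp_apply, TensorProduct.mk_apply,
    Finset.mul_sum, Finset.sum_mul, Algebra.TensorProduct.tmul_mul_tmul, one_mul, mul_one,
    lam_mul_rhoInv hS, TensorProduct.tmul_sum, LinearMap.flip_apply]
  exact Finset.sum_comm

/-- Partiality is absorbed here: φ(a) = φ(a)φ(1) provides the φ(1) needed to recognise φ(h₁ · c). -/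
theorem phi_mul_psi_mul_phi (a c : A) (h : H) :
    α.phi Sinv b p a * psi A (h ⊗ₜ 1) * α.phi Sinv b p c = ∑ i ∈ (ℛ k h).index,
      α.phi Sinv b p (a * α.act ((ℛ k h).left i) c) * psi A ((ℛ k h).right i ⊗ₜ 1) := by
  rw [mul_assoc, α.psi_tmul_one_mul_phi hbp hS, Finset.mul_sum]
  refine Finset.sum_congr rfl fun i _ => ?_
  rw [α.phi_mul hbp hS, α.phi_act hbp hS, ← mul_assoc (α.phi Sinv b p a) (α.phi Sinv b p 1),
    ← α.phi_mul hbp hS, mul_one, mul_assoc]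

end PartialHopfAction

/-! ### The homomorphism Φ and its image in the corner -/

namespace PartialHopfAction

variable {k H A : Type*} [CommRing k] [Ring H] [HopfAlgebra k H] [Ring A] [Algebra k A]

theorem psi_tmul_eq_mul (h : H) (f : HDual k H) :
    psi A (h ⊗ₜ f) = psi A (h ⊗ₜ[k] 1) * psi A (1 ⊗ₜ f) := by
  simp [psi, ← lam_tmul_eq_mul]

theorem psi_mul_tmul (h g : H) (f : HDual k H) :
    psi A (h ⊗ₜ[k] 1) * psi A (g ⊗ₜ f) = psi A ((h * g) ⊗ₜ f) := by
  simp [psi, lam_mul_tmul]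

section

variable (α : PartialHopfAction k H A)
  {n : ℕ} (b : Fin n → H) (p : Fin n → HDual k H) (Sinv : HDual k H ≃ₗ[k] HDual k H)

/-- `φ` as a linear map. -/
def phiLinear : A →ₗ[k] A ⊗[k] Module.End k H :=
  ∑ i, (TensorProduct.mk k A (Module.End k H)).flip (rhoInv Sinv (p i)) ∘ₗ α.act (b i)

theorem phiLinear_apply (a : A) : α.phiLinear b p Sinv a = α.phi Sinv b p a := by
  simp [phiLinear, phi, rhoInv_eq]

end

variable [Module.Finite k H] [Module.Projective k H]

theorem psi_mul_psi (g : H) (f l : HDual k H) :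
    psi A (1 ⊗ₜ[k] f) * psi A (g ⊗ₜ l) = ∑ i ∈ (ℛ k f).index,
      psi A (hitLeft k H ((ℛ k f).left i) g ⊗ₜ ((ℛ k f).right i * l)) := by
  simp [psi, lam_mul_lam, TensorProduct.tmul_sum]

variable (α : PartialHopfAction k H A)

theorem Double.induction {P : α.Double → Prop} (x : α.Double) (h0 : P 0)
    (hmk : ∀ a h f, P (Double.mk α a h f)) (hadd : ∀ x y, P x → P y → P (x + y)) : P x :=
  TensorProduct.induction_on (motive := P) x h0
    (fun y f => Ambient.induction α (P := fun y => P (y ⊗ₜ[k] f : α.Ambient ⊗[k] HDual k H)) y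
      (by rw [TensorProduct.zero_tmul]; exact h0) (fun a h => hmk a h f)
      (fun y z hy hz => by rw [TensorProduct.add_tmul]; exact hadd _ _ hy hz)) hadd

theorem Double.mk_mul_mk (a c : A) (h g : H) (f l : HDual k H) :
    Double.mk α a h f * Double.mk α c g l = ∑ i ∈ (ℛ k f).index, ∑ j ∈ (ℛ k h).index,
      Double.mk α (a * α.act ((ℛ k h).left j) c)
        ((ℛ k h).right j * hitLeft k H ((ℛ k f).left i) g) ((ℛ k f).right i * l) := by
  refine (smashMul_tmul α.dualAct _ _ _ _ (ℛ k f)).trans ?_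
  refine Finset.sum_congr rfl fun i _ => ?_
  rw [dualAct_mk, Ambient.mk_mul_mk α _ _ _ _ (ℛ k h), TensorProduct.sum_tmul]
  rfl

variable {n : ℕ} (b : Fin n → H) (p : Fin n → HDual k H) (Sinv : HDual k H ≃ₗ[k] HDual k H)

/-- The linear map `a ⊗ h # f ↦ φ(a) ψ(h # f)`. -/
def dualityLinear : α.Double →ₗ[k] A ⊗[k] Module.End k H :=
  (LinearMap.mul' k (A ⊗[k] Module.End k H) ∘ₗ
    TensorProduct.map (α.phiLinear b p Sinv) (psi A) ∘ₗ
    (TensorProduct.assoc k A H (HDual k H)).toLinearMap :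
      (A ⊗[k] H) ⊗[k] HDual k H →ₗ[k] A ⊗[k] Module.End k H)

theorem dualityLinear_mk (a : A) (h : H) (f : HDual k H) :
    α.dualityLinear b p Sinv (Double.mk α a h f) =
      α.phi Sinv b p a * psi A (h ⊗ₜ f) := by
  rw [← phiLinear_apply]
  rfl

variable {b p Sinv} (hbp : ∀ h, ∑ i, (p i).ofConv h • b i = h)
  (hS : ∀ f, Sinv (antipode k f) = f)
include hbp hS

theorem dualityLinear_mul (x y : α.Double) : α.dualityLinear b p Sinv (x * y) =
    α.dualityLinear b p Sinv x * α.dualityLinear b p Sinv y := by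
  induction x using Double.induction with
  | h0 => simp
  | hadd x x' hx hx' => simp only [map_add, add_mul, hx, hx']
  | hmk a h f =>
  induction y using Double.induction with
  | h0 => simp
  | hadd x x' hx hx' => simp only [map_add, mul_add, hx, hx']
  | hmk c g l =>
    calc _ = ∑ i ∈ (ℛ k f).index, ∑ j ∈ (ℛ k h).index,
          α.phi Sinv b p (a * α.act ((ℛ k h).left j) c) * (psi A ((ℛ k h).right j ⊗ₜ 1) *
            psi A (hitLeft k H ((ℛ k f).left i) g ⊗ₜ ((ℛ k f).right i * l))) := by
          simp only [Double.mk_mul_mk, map_sum, dualityLinear_mk, psi_mul_tmul]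
      _ = α.phi Sinv b p a * psi A (h ⊗ₜ 1) * α.phi Sinv b p c *
            (psi A (1 ⊗ₜ f) * psi A (g ⊗ₜ l)) := by
          simp only [phi_mul_psi_mul_phi α hbp hS, psi_mul_psi, Finset.sum_mul_sum, mul_assoc]
          exact Finset.sum_comm
      _ = α.phi Sinv b p a * psi A (h ⊗ₜ 1) * (α.phi Sinv b p c *
            psi A (1 ⊗ₜ f)) * psi A (g ⊗ₜ l) := by simp only [mul_assoc]
      _ = _ := by
          rw [← psi_one_tmul_mul_phi, dualityLinear_mk, dualityLinear_mk, psi_tmul_eq_mul h f]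
          simp only [mul_assoc]

theorem isIdempotentElem_phi_one : IsIdempotentElem (α.phi Sinv b p 1) := by
  rw [IsIdempotentElem, ← α.phi_mul hbp hS, mul_one]

theorem dualityLinear_eq_of_mem_partialDouble {x : α.Double} (hx : x ∈ α.partialDouble) :
    α.dualityLinear b p Sinv x =
      α.phi Sinv b p 1 * α.dualityLinear b p Sinv x * α.phi Sinv b p 1 := by
  -- `D` is Φ read on the underlying tensor product; only its values on pure tensors, recorded in
  -- `hmk`, are used.
  let D : α.Ambient ⊗[k] HDual k H →ₗ[k] A ⊗[k] Module.End k H := α.dualityLinear b p Sinv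
  have hmk : ∀ a h f, D (Ambient.mk α a h ⊗ₜ f) = α.phi Sinv b p a * psi A (h ⊗ₜ f) :=
    α.dualityLinear_mk b p Sinv
  suffices h : ∀ t, D (TensorProduct.map α.partialSmash.subtype LinearMap.id t) =
      α.phi Sinv b p 1 * D (TensorProduct.map α.partialSmash.subtype LinearMap.id t) *
        α.phi Sinv b p 1 by
    obtain ⟨t, rfl⟩ := hx
    exact h t
  clear_value D
  intro t
  induction t with
  | zero => simp
  | add u v hu hv =>
    simp only [map_add, mul_add, add_mul]
    rw [← hu, ← hv]
  | tmul y f =>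
    obtain ⟨_, y, rfl⟩ := y
    simp only [TensorProduct.map_tmul, Submodule.subtype_apply, LinearMap.mulRight_apply,
      LinearMap.id_apply]
    induction y using Ambient.induction with
    | h0 => simp
    | hadd y z hy hz =>
      simp only [add_mul, TensorProduct.add_tmul, map_add, mul_add]
      rw [← hy, ← hz]
    | hmk a h =>
      -- Right multiplication by 1 ⊗ 1 becomes right multiplication by φ(1), which commutes with ψ(1
      -- # f).
      have key : D ((Ambient.mk α a h * Ambient.mk α 1 1) ⊗ₜ[k] f) =
          α.phi Sinv b p a * psi A (h ⊗ₜ f) * α.phi Sinv b p 1 := by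
        rw [Ambient.mk_mul_mk α _ _ _ _ (ℛ k h), TensorProduct.sum_tmul, map_sum,
          psi_tmul_eq_mul, mul_assoc, mul_assoc, psi_one_tmul_mul_phi, ← mul_assoc, ← mul_assoc,
          α.phi_mul_psi_mul_phi hbp hS, Finset.sum_mul]
        refine Finset.sum_congr rfl fun i _ => ?_
        rw [mul_one, mul_assoc, ← psi_tmul_eq_mul, hmk]
      rw [key]
      simp only [mul_assoc, (α.isIdempotentElem_phi_one hbp hS).eq]
      simp only [← mul_assoc, ← α.phi_mul hbp hS, one_mul]

end PartialHopfAction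

end HopfDuality

end

open HopfDuality
theorem mainTheorem7 {k H A : Type*} [CommRing k] [Ring H] [HopfAlgebra k H]
    [Module.Finite k H] [Module.Projective k H] [Ring A] [Algebra k A]
    (α : PartialHopfAction k H A)
    {n : ℕ} (b : Fin n → H) (p : Fin n → HDual k H)
    (hbp : ∀ h : H, ∑ i, (p i).ofConv h • b i = h) :
    ∃ hS : Function.Bijective (HopfAlgebra.antipode k : HDual k H →ₗ[k] HDual k H),
    ∃ Sinv : HDual k H ≃ₗ[k] HDual k H,
      Sinv = (LinearEquiv.ofBijective (HopfAlgebra.antipode k) hS).symm ∧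
    ∃ e : A ⊗[k] Module.End k H,
      e = ∑ i, α.act (b i) 1 ⊗ₜ[k] rho k H (Sinv (p i) ⊗ₜ[k] 1) ∧
      IsIdempotentElem e ∧
      ∃ Φ : α.Double →ₙₐ[k] A ⊗[k] Module.End k H,
        (∀ (a : A) (h : H) (f : HDual k H),
          Φ (PartialHopfAction.Double.mk α a h f) =
            α.phi Sinv b p a * PartialHopfAction.psi A (h ⊗ₜ[k] f)) ∧
        ∀ γ ∈ α.partialDouble, ∃ x : A ⊗[k] Module.End k H, Φ γ = e * x * e := by
  have hS := antipode_bijective_dual k H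
  refine ⟨hS, _, rfl, _, rfl, ?_⟩
  have hinv : ∀ f, (LinearEquiv.ofBijective (HopfAlgebra.antipode k) hS).symm
      (HopfAlgebra.antipode k f) = f :=
    (LinearEquiv.ofBijective (HopfAlgebra.antipode k) hS).symm_apply_apply
  refine ⟨α.isIdempotentElem_phi_one hbp hinv,
    { α.dualityLinear b p _ with
      map_zero' := map_zero _
      map_mul' := α.dualityLinear_mul hbp hinv }, fun a h f => α.dualityLinear_mk b p _ a h f,
    -- The witness is Φ(γ) itself, since e = φ(1) fixes it on both sides.
    fun γ hγ => ⟨_, α.dualityLinear_eq_of_mem_partialDouble hbp hinv hγ⟩⟩
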